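/- Let $N\ge 1$, let $\Omega\subset\mathbb R^N$ be a bounded open set, let $p>2$, $q>p-1$, $0<T<\infty$, $Q_T=\Omega\times(0,T)$, $m=\max(p,q)$, and let $g:\partial\Omega\to\mathbb R$ and $u_0:\Omega\to\mathbb R$ be given functions (this includes the case of a bounded domain $\Omega$ of class $C^{2+\alpha}$, $\alpha>0$, of boundary data $g\ge 0$ that is the trace of a function in $C^2(\overline\Omega)$, and of initial data $0\le u_0\in W^{1,\infty}(\Omega)$ with $u_0=g$ on $\partial\Omega$). Consider the problem $$\partial_t u-\operatorname{div}\big(|\nabla u|^{p-2}\nabla u\big)=|\nabla u|^q \ \text{ in } Q_T,\qquad u=g \ \text{ on } \partial\Omega\times(0,T),\qquad u(\cdot,0)=u_0 \ \text{ in } \Omega. \tag{P}$$ A function $u$ is called a weak sub-solution (respectively super-solution) of (P) on $Q_T$ if * $u\in C(\overline\Omega\times[0,T))\cap L^m((0,T);W^{1,m}(\Omega))$ and its weak time derivative satisfies $u_t\in L^2((0,T);L^2(\Omega))$; * $u(\cdot,0)\le u_0$ (respectively $\ge$) almost everywhere in $\Omega$, and $u\le g$ (respectively $\ge$) on $\partial\Omega\times(0,T)$;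 * for all $\psi\in C(\overline{Q_T})\cap L^p((0,T);W^{1,p}(\Omega))$ with $\psi\ge 0$ and $\psi=0$ on $\partial\Omega\times(0,T)$, $$\iint_{Q_T}\big(u_t\,\psi+|\nabla u|^{p-2}\nabla u\cdot\nabla\psi\big)\,dx\,dt\ \le\ \iint_{Q_T}|\nabla u|^q\,\psi\,dx\,dt \qquad(\text{respectively}\ \ge).$$ Let $u$ be a weak sub-solution and $v$ a weak super-solution of (P) on $Q_T$, for the same $g$ and $u_0$, and assume that $u,v\in L^\infty((0,T);W^{1,\infty}(\Omega))$. Then $u\le v$ everywhere on $\Omega\times(0,T)$. -/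

import Mathlib

open MeasureTheory Set
open scoped ENNReal ContDiff

noncomputable section

namespace DegenerateHJ

/-- Test functions of an open set `U`: smooth functions with compact support contained in `U`. -/
def IsTestFunction {F : Type*} [NormedAddCommGroup F] [NormedSpace ℝ F]
    (U : Set F) (φ : F → ℝ) : Prop :=
  ContDiff ℝ ∞ φ ∧ HasCompactSupport φ ∧ tsupport φ ⊆ U

/-- `G` is the weak (distributional) gradient of `f` in the open set `Ω ⊆ ℝᴺ`. -/
structure HasWeakGradient {N : ℕ} (Ω : Set (EuclideanSpace ℝ (Fin N)))
    (f : EuclideanSpace ℝ (Fin N) → ℝ)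
    (G : EuclideanSpace ℝ (Fin N) → EuclideanSpace ℝ (Fin N)) : Prop where
  locallyIntegrable : LocallyIntegrableOn f Ω
  locallyIntegrable_grad : LocallyIntegrableOn G Ω
  integral_eq : ∀ φ : EuclideanSpace ℝ (Fin N) → ℝ, IsTestFunction Ω φ → ∀ i : Fin N,
    ∫ x in Ω, f x * fderiv ℝ φ x (EuclideanSpace.single i 1) = - ∫ x in Ω, G x i * φ x

/-- The parabolic cylinder `Q_T = Ω × (0, T)`. -/
def cylinder {N : ℕ} (Ω : Set (EuclideanSpace ℝ (Fin N))) (T : ℝ) :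
    Set (EuclideanSpace ℝ (Fin N) × ℝ) :=
  Ω ×ˢ Ioo 0 T

/-- `u ∈ L^r((0, T); W^{1,r}(Ω))` and `Du` is its spatial gradient: for almost every `t` the
slice `Du(·, t)` is the weak gradient of `u(·, t)` in `Ω`, and `u` and `Du` have finite `L^r` norm
in `t` and `x` (for `r = ∞`: finite essential supremum over `t` of the `W^{1,∞}(Ω)` norm). -/
structure HasSpatialGradient {N : ℕ} (Ω : Set (EuclideanSpace ℝ (Fin N))) (T : ℝ) (r : ℝ≥0∞)
    (u : EuclideanSpace ℝ (Fin N) × ℝ → ℝ)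
    (Du : EuclideanSpace ℝ (Fin N) × ℝ → EuclideanSpace ℝ (Fin N)) : Prop where
  memLp : MemLp u r (volume.restrict (cylinder Ω T))
  memLp_grad : MemLp Du r (volume.restrict (cylinder Ω T))
  weakGradient : ∀ᵐ t ∂(volume.restrict (Ioo 0 T)),
    HasWeakGradient Ω (fun x => u (x, t)) (fun x => Du (x, t))

/-- The space `L^r((0, T); W^{1,r}(Ω))`. -/
def MemLpW1 {N : ℕ} (Ω : Set (EuclideanSpace ℝ (Fin N))) (T : ℝ) (r : ℝ≥0∞)
    (u : EuclideanSpace ℝ (Fin N) × ℝ → ℝ) : Prop :=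
  ∃ Du, HasSpatialGradient Ω T r u Du

/-- `ut ∈ L²((0, T); L²(Ω))` is the weak time derivative of `u` in `Q_T`. -/
structure HasL2TimeDeriv {N : ℕ} (Ω : Set (EuclideanSpace ℝ (Fin N))) (T : ℝ)
    (u ut : EuclideanSpace ℝ (Fin N) × ℝ → ℝ) : Prop where
  memLp : MemLp ut 2 (volume.restrict (cylinder Ω T))
  integral_eq : ∀ φ : EuclideanSpace ℝ (Fin N) × ℝ → ℝ, IsTestFunction (cylinder Ω T) φ →
    ∫ z in cylinder Ω T, u z * fderiv ℝ φ z (0, 1) = - ∫ z in cylinder Ω T, ut z * φ z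

/-- The admissible functions of the weak formulation, with their spatial gradient: nonnegative
`ψ ∈ C(closure Q_T) ∩ L^p((0, T); W^{1,p}(Ω))` vanishing on `∂Ω × (0, T)`. -/
structure IsAdmissible {N : ℕ} (p : ℝ) (Ω : Set (EuclideanSpace ℝ (Fin N))) (T : ℝ)
    (ψ : EuclideanSpace ℝ (Fin N) × ℝ → ℝ)
    (Dψ : EuclideanSpace ℝ (Fin N) × ℝ → EuclideanSpace ℝ (Fin N)) : Prop where
  continuousOn : ContinuousOn ψ (closure Ω ×ˢ Icc 0 T)
  gradient : HasSpatialGradient Ω T (ENNReal.ofReal p) ψ Dψ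
  nonneg : ∀ z ∈ closure Ω ×ˢ Icc 0 T, 0 ≤ ψ z
  boundary : ∀ x ∈ frontier Ω, ∀ t ∈ Ioo 0 T, ψ (x, t) = 0

/-- `∬_{Q_T} u_t ψ + |∇u|^{p-2} ∇u · ∇ψ dx dt`. -/
def diffusionForm {N : ℕ} (p : ℝ) (Ω : Set (EuclideanSpace ℝ (Fin N))) (T : ℝ)
    (ut : EuclideanSpace ℝ (Fin N) × ℝ → ℝ)
    (Du : EuclideanSpace ℝ (Fin N) × ℝ → EuclideanSpace ℝ (Fin N))
    (ψ : EuclideanSpace ℝ (Fin N) × ℝ → ℝ)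
    (Dψ : EuclideanSpace ℝ (Fin N) × ℝ → EuclideanSpace ℝ (Fin N)) : ℝ :=
  ∫ z in cylinder Ω T, (ut z * ψ z + ‖Du z‖ ^ (p - 2) * inner ℝ (Du z) (Dψ z))

/-- `∬_{Q_T} |∇u|^q ψ dx dt`. -/
def sourceForm {N : ℕ} (q : ℝ) (Ω : Set (EuclideanSpace ℝ (Fin N))) (T : ℝ)
    (Du : EuclideanSpace ℝ (Fin N) × ℝ → EuclideanSpace ℝ (Fin N))
    (ψ : EuclideanSpace ℝ (Fin N) × ℝ → ℝ) : ℝ :=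
  ∫ z in cylinder Ω T, ‖Du z‖ ^ q * ψ z

/-- `u` is a weak sub-solution on `Q_T` of `∂ₜu - div(|∇u|^{p-2} ∇u) = |∇u|^q` with boundary data
`g` and initial data `u₀`. -/
structure IsWeakSubsolution {N : ℕ} (p q : ℝ) (Ω : Set (EuclideanSpace ℝ (Fin N))) (T : ℝ)
    (g u₀ : EuclideanSpace ℝ (Fin N) → ℝ) (u : EuclideanSpace ℝ (Fin N) × ℝ → ℝ) : Prop where
  continuousOn : ContinuousOn u (closure Ω ×ˢ Ico 0 T)
  initial : ∀ᵐ x ∂(volume.restrict Ω), u (x, 0) ≤ u₀ x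
  boundary : ∀ x ∈ frontier Ω, ∀ t ∈ Ioo 0 T, u (x, t) ≤ g x
  weak : ∃ Du ut,
    HasSpatialGradient Ω T (ENNReal.ofReal (max p q)) u Du ∧ HasL2TimeDeriv Ω T u ut ∧
    ∀ ψ Dψ, IsAdmissible p Ω T ψ Dψ →
      diffusionForm p Ω T ut Du ψ Dψ ≤ sourceForm q Ω T Du ψ

/-- `v` is a weak super-solution on `Q_T` of `∂ₜv - div(|∇v|^{p-2} ∇v) = |∇v|^q` with boundary
data `g` and initial data `u₀`. -/
structure IsWeakSupersolution {N : ℕ} (p q : ℝ) (Ω : Set (EuclideanSpace ℝ (Fin N))) (T : ℝ)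
    (g u₀ : EuclideanSpace ℝ (Fin N) → ℝ) (v : EuclideanSpace ℝ (Fin N) × ℝ → ℝ) : Prop where
  continuousOn : ContinuousOn v (closure Ω ×ˢ Ico 0 T)
  initial : ∀ᵐ x ∂(volume.restrict Ω), u₀ x ≤ v (x, 0)
  boundary : ∀ x ∈ frontier Ω, ∀ t ∈ Ioo 0 T, g x ≤ v (x, t)
  weak : ∃ Dv vt,
    HasSpatialGradient Ω T (ENNReal.ofReal (max p q)) v Dv ∧ HasL2TimeDeriv Ω T v vt ∧
    ∀ ψ Dψ, IsAdmissible p Ω T ψ Dψ →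
      sourceForm q Ω T Dv ψ ≤ diffusionForm p Ω T vt Dv ψ Dψ

end DegenerateHJ

end

/-!
The proof is a weighted energy estimate for `w = u - v`. Fix `ε > 0` and `s < T`. Since `w ≤ 0` on
the parabolic boundary, the set where `w ≥ ε` and `t ≤ s` is a compact subset of the open cylinder
(`exists_compact_superlevel`), so a truncation `((w - ε)⁺)ⁿ η(t)`, with `η` a smooth cutoff that
vanishes for `t ≥ s`, has compact support in the cylinder. No boundary terms occur, and no
regularity of `∂Ω` is needed.

Both weak formulations are tested with `ψ = ((w - ε)⁺)² η`. The square makes the truncation a `C¹`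
function of `w`; hence its weak derivatives come from the `C¹` chain rule
(`HasWeakDirDeriv.comp`), which is proved by mollification for one direction at a time and serves
both for the spatial gradient on time slices (`isAdmissible_truncation`) and for the time
derivative on the cylinder (`integral_truncation_deriv`).

The gradients are bounded, because weak gradients are unique (`HasSpatialGradient.ae_eq`). For
`|a|, |b| ≤ M` and `q > p - 1`, one factor `|a|^q - |b|^q` is at most a multiple of `|a| - |b|`, the
other a multiple of `|a|^(p-1) - |b|^(p-1)`, so that
`(|a|^q - |b|^q)² ≤ C (|a|^(p-2) a - |b|^(p-2) b) · (a - b)` (`sq_rpow_sub_rpow_le`,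
`radial_le_inner_flux_sub`). By Young's inequality the diffusion absorbs the difference of the
source terms (`source_sub_mul_le`), which leaves
`∬ wₜ ((w - ε)⁺)² η ≤ C ∬ ((w - ε)⁺)³ η` (`integral_time_deriv_mul_le`). The left side equals
`-(1/3) ∬ ((w - ε)⁺)³ η'`; choosing `η` with `-η' ≥ (3C + 1) η` forces `∬ ((w - ε)⁺)³ η = 0`, that
is, `w ≤ ε` before the time `s`.
-/

namespace DegenerateHJ

open Filter Topology

/-! ### Directional weak derivatives and the chain rule -/

section WeakDerivative

open scoped Convolution Manifold

variable {F : Type*} [NormedAddCommGroup F] [NormedSpace ℝ F] [FiniteDimensional ℝ F]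

/-- A compact subset `K` of an open set `U` has a test function of `U` that equals one near `K`. -/
lemma exists_isTestFunction_eq_one {K U : Set F} (hK : IsCompact K) (hU : IsOpen U)
    (hKU : K ⊆ U) : ∃ θ : F → ℝ, IsTestFunction U θ ∧ ∀ᶠ x in 𝓝ˢ K, θ x = 1 := by
  obtain ⟨L, hL, hKL, hLU⟩ := exists_compact_between hK hU hKU
  obtain ⟨θ, h1, h0, -⟩ := exists_contMDiffMap_one_nhds_of_subset_interior (n := (⊤ : ℕ∞)) 𝓘(ℝ, F)
    hK.isClosed hKL
  have hsub : tsupport θ ⊆ L :=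
    closure_minimal (fun x hx => by_contra fun h => hx (h0 x h)) hL.isClosed
  exact ⟨θ, ⟨θ.contMDiff.contDiff, hL.of_isClosed_subset (isClosed_tsupport _) hsub,
    hsub.trans hLU⟩, h1⟩

variable [MeasurableSpace F] [BorelSpace F] (μ : Measure F) [μ.IsAddHaarMeasure]

/-- `g` is the weak derivative of `f` in the direction `e` in the open set `U`: the derivative of
`f` along `e` as a distribution. -/
def HasWeakDirDeriv (U : Set F) (e : F) (f g : F → ℝ) : Prop :=
  ∀ φ : F → ℝ, IsTestFunction U φ →
    ∫ x in U, f x * fderiv ℝ φ x e ∂μ = - ∫ x in U, g x * φ x ∂μ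

lemma fderiv_convolution_lsmul_apply {ρ f : F → ℝ} (hρ : ContDiff ℝ ∞ ρ)
    (hρc : HasCompactSupport ρ) (hf : LocallyIntegrable f μ) (x e : F) :
    fderiv ℝ (ρ ⋆[ContinuousLinearMap.lsmul ℝ ℝ, μ] f) x e
      = ∫ y, fderiv ℝ ρ (x - y) e * f y ∂μ := by
  have h1 : ContDiff ℝ 1 ρ := hρ.of_le (by simp)
  rw [← convolution_flip, (hρc.hasFDerivAt_convolution_right _ hf h1 x).fderiv,
    convolution_precompR_apply _ hf (hρc.fderiv ℝ) (h1.continuous_fderiv (by simp))]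
  rfl

/-- Moving a derivative and an even mollifier from one factor to the other changes the sign. -/
lemma integral_mul_fderiv_convolution {ρ f ψ : F → ℝ} (hρ : ContDiff ℝ ∞ ρ)
    (hρc : HasCompactSupport ρ) (heven : ∀ x, ρ (-x) = ρ x)
    (hf : Continuous f) (hfc : HasCompactSupport f)
    (hψ : Continuous ψ) (hψc : HasCompactSupport ψ) (e : F) :
    ∫ x, f x * fderiv ℝ (ρ ⋆[ContinuousLinearMap.lsmul ℝ ℝ, μ] ψ) x e ∂μ
      = - ∫ x, ψ x * fderiv ℝ (ρ ⋆[ContinuousLinearMap.lsmul ℝ ℝ, μ] f) x e ∂μ := by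
  have h1 : ContDiff ℝ 1 ρ := hρ.of_le (by simp)
  have hd : Continuous fun x => fderiv ℝ ρ x e :=
    (h1.continuous_fderiv (by simp)).clm_apply continuous_const
  have hodd : ∀ x, fderiv ℝ ρ (-x) e = - fderiv ℝ ρ x e := by
    intro x
    have h2 : HasFDerivAt (fun y => ρ (-y)) _ x := HasFDerivAt.comp x
      ((h1.differentiable (by simp)) (-x)).hasFDerivAt (hasFDerivAt_id x).neg
    rw [funext heven] at h2
    rw [h2.fderiv]
    simp
  simp_rw [fderiv_convolution_lsmul_apply μ hρ hρc (hψ.locallyIntegrable),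
    fderiv_convolution_lsmul_apply μ hρ hρc (hf.locallyIntegrable), ← integral_const_mul]
  rw [integral_integral_swap_of_hasCompactSupport, ← integral_neg]
  · congr 1; ext y
    rw [← integral_neg]
    congr 1; ext x
    have := hodd (y - x)
    rw [neg_sub] at this
    rw [this]; ring
  · exact Continuous.mul (hf.comp continuous_fst) (Continuous.mul
      (hd.comp (continuous_fst.sub continuous_snd)) (hψ.comp continuous_snd))
  · refine HasCompactSupport.intro (hfc.isCompact.prod hψc.isCompact) fun z hz => ?_
    rw [mem_prod, not_and_or] at hz
    rcases hz with hz | hz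
    · simp [Function.uncurry_def, image_eq_zero_of_notMem_tsupport hz]
    · simp [Function.uncurry_def, image_eq_zero_of_notMem_tsupport hz]

lemma tendsto_uncurry_convolution {ρ : ℕ → ContDiffBump (0 : F)}
    (hρ : Tendsto (fun n => (ρ n).rOut) atTop (𝓝 0)) {f : F → ℝ} (hf : Continuous f) (x : F) :
    Tendsto (fun z : ℕ × F =>
      ((ρ z.1).normed μ ⋆[ContinuousLinearMap.lsmul ℝ ℝ, μ] f : F → ℝ) z.2)
      (atTop ×ˢ 𝓝 x) (𝓝 (f x)) :=
  ContDiffBump.convolution_tendsto_right (φ := fun i : ℕ × F => ρ i.1) (g := fun _ => f)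
    (k := Prod.snd) (x₀ := x) (hρ.comp tendsto_fst)
    (Eventually.of_forall fun _ => hf.aestronglyMeasurable)
    ((hf.tendsto x).comp tendsto_snd) tendsto_snd

/-- Chain rule: composition of a continuous function `f`, weakly differentiable in the direction
`e`, with a `C¹` function `Φ`. No integrability of a power of the derivative is needed: with
`fₙ` mollifications of `f`, the function `Φ(fₙ)` is differentiated classically, and the mollifier
is then moved from `f` to the test function `Φ'(fₙ) φ`, whose mollifications stay bounded with
their supports in a fixed compact set, and converge pointwise. -/
theorem HasWeakDirDeriv.comp {U : Set F} (hU : IsOpen U) {e : F} {f g : F → ℝ}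
    (hf : ContinuousOn f U) (hg : LocallyIntegrableOn g U μ) (h : HasWeakDirDeriv μ U e f g)
    {Φ Φ' : ℝ → ℝ} (hΦ : ∀ s, HasDerivAt Φ (Φ' s) s) (hΦ' : Continuous Φ') :
    HasWeakDirDeriv μ U e (fun x => Φ (f x)) (fun x => Φ' (f x) * g x) := by
  intro φ hφ
  obtain ⟨hφs, hφc, hφU⟩ := hφ
  obtain ⟨δ, hδ, hδU⟩ := hφc.isCompact.exists_cthickening_subset_open hU hφU
  set K := Metric.cthickening δ (tsupport φ) with hKdef
  have hK : IsCompact K := hφc.isCompact.cthickening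
  have hφK : tsupport φ ⊆ K := Metric.self_subset_cthickening _
  obtain ⟨θ, ⟨hθs, hθc, hθU⟩, hθ1⟩ := exists_isTestFunction_eq_one hK hU hδU
  have hθK : ∀ x ∈ K, θ x = 1 := fun x hx => hθ1.self_of_nhdsSet x hx
  have hφ1 : ContDiff ℝ 1 φ := hφs.of_le (by simp)
  have hφd : Continuous fun x => fderiv ℝ φ x e :=
    (hφ1.continuous_fderiv (by simp)).clm_apply continuous_const
  -- Only the values of `f` near the support of `φ` matter.
  set f₀ : F → ℝ := fun x => θ x * f x with hf₀def
  have hf₀K : ∀ x ∈ K, f₀ x = f x := fun x hx => by simp [hf₀def, hθK x hx]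
  have hf₀ : Continuous f₀ := by
    refine continuous_iff_continuousAt.2 fun x => ?_
    by_cases hx : x ∈ U
    · exact hθs.continuous.continuousAt.mul (hf.continuousAt (hU.mem_nhds hx))
    · have h0 : f₀ =ᶠ[𝓝 x] fun _ => 0 := by
        filter_upwards [(isClosed_tsupport θ).isOpen_compl.mem_nhds fun hx' => hx (hθU hx')]
          with y hy
        simp [hf₀def, image_eq_zero_of_notMem_tsupport hy]
      exact (continuousAt_const).congr h0.symm
  have hf₀c : HasCompactSupport f₀ := hθc.mul_right
  have hΦc : Continuous Φ := continuous_iff_continuousAt.2 fun s => (hΦ s).continuousAt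
  have hΦ1 : ContDiff ℝ 1 Φ := by
    rw [contDiff_one_iff_deriv]
    exact ⟨fun s => (hΦ s).differentiableAt, by rwa [funext fun s => (hΦ s).deriv]⟩
  let ρ : ℕ → ContDiffBump (0 : F) := fun n =>
    ⟨δ / 2 / (n + 1), δ / (n + 1), by positivity, by gcongr; linarith⟩
  have hρδ : ∀ n, (ρ n).rOut ≤ δ := fun n => div_le_self hδ.le (by simp)
  have hρ0 : Tendsto (fun n => (ρ n).rOut) atTop (𝓝 0) :=
    tendsto_const_div_atTop_nhds_zero_nat δ |>.comp (tendsto_add_atTop_nat 1) |>.congr fun n => by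
      simp [ρ]
  have hρs : ∀ n, ContDiff ℝ ∞ ((ρ n).normed μ) := fun n => (ρ n).contDiff_normed
  have hρc : ∀ n, HasCompactSupport ((ρ n).normed μ) := fun n => (ρ n).hasCompactSupport_normed
  set fn : ℕ → F → ℝ := fun n => (ρ n).normed μ ⋆[ContinuousLinearMap.lsmul ℝ ℝ, μ] f₀ with hfn
  have hfns : ∀ n, ContDiff ℝ ∞ (fn n) := fun n =>
    (hρc n).contDiff_convolution_left _ (hρs n) hf₀.locallyIntegrable
  have hfn1 : ∀ n, ContDiff ℝ 1 (fn n) := fun n => (hfns n).of_le (by simp)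
  set ψ : ℕ → F → ℝ := fun n x => Φ' (fn n x) * φ x with hψdef
  have hψc : ∀ n, Continuous (ψ n) := fun n =>
    (hΦ'.comp (hfns n).continuous).mul hφs.continuous
  have hψs : ∀ n, HasCompactSupport (ψ n) := fun n => hφc.mul_left
  set χ : ℕ → F → ℝ := fun n => (ρ n).normed μ ⋆[ContinuousLinearMap.lsmul ℝ ℝ, μ] ψ n with hχdef
  have hχs : ∀ n, ContDiff ℝ ∞ (χ n) := fun n =>
    (hρc n).contDiff_convolution_left _ (hρs n) (hψc n).locallyIntegrable
  have hχK : ∀ n, tsupport (χ n) ⊆ K := by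
    intro n
    refine closure_minimal ?_ hK.isClosed
    refine (support_convolution_subset _).trans ?_
    rintro _ ⟨a, ha, b, hb, rfl⟩
    rw [(ρ n).support_normed_eq] at ha
    have hb' : b ∈ tsupport φ := subset_closure fun h0 => hb (by simp [hψdef, h0])
    refine Metric.mem_cthickening_of_dist_le _ b δ _ hb' ?_
    rw [dist_eq_norm, add_sub_cancel_right]
    rw [mem_ball_zero_iff] at ha
    exact ha.le.trans (hρδ n)
  have hχc : ∀ n, HasCompactSupport (χ n) := fun n =>
    hK.of_isClosed_subset (isClosed_tsupport _) (hχK n)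
  -- The test function for the weak derivative of `f` is `χ n`, the mollification of `Φ'(fₙ) φ`.
  have key : ∀ n, ∫ x, Φ (fn n x) * fderiv ℝ φ x e ∂μ = - ∫ x in U, g x * χ n x ∂μ := by
    intro n
    have hcomp : ∀ x, fderiv ℝ (fun y => Φ (fn n y)) x e = Φ' (fn n x) * fderiv ℝ (fn n) x e := by
      intro x
      have := (hΦ (fn n x)).comp_hasFDerivAt x ((hfn1 n).differentiable (by simp) x).hasFDerivAt
      rw [HasFDerivAt.fderiv (f := fun y => Φ (fn n y)) this]
      simp
    have hcf : ContDiff ℝ 1 (fun y => Φ (fn n y)) := hΦ1.comp (hfn1 n)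
    have hcd : Continuous fun x => fderiv ℝ (fun y => Φ (fn n y)) x e :=
      (hcf.continuous_fderiv (by simp)).clm_apply continuous_const
    rw [integral_mul_fderiv_eq_neg_fderiv_mul_of_integrable
      (((hcd.mul hφs.continuous)).integrable_of_hasCompactSupport hφc.mul_left)
      ((hcf.continuous.mul hφd).integrable_of_hasCompactSupport
        ((hφc.fderiv_apply ℝ e).mul_left))
      ((hcf.continuous.mul hφs.continuous).integrable_of_hasCompactSupport hφc.mul_left)
      (fun x _ => hcf.differentiable (by simp) x) (fun x _ => hφ1.differentiable (by simp) x)]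
    have h1 := integral_mul_fderiv_convolution μ (hρs n) (hρc n)
      (fun x => (ρ n).normed_neg x) hf₀ hf₀c (hψc n) (hψs n) e
    have h2 := h (χ n) ⟨hχs n, hχc n, (hχK n).trans hδU⟩
    have h3 : ∫ x, f₀ x * fderiv ℝ (χ n) x e ∂μ = ∫ x in U, f x * fderiv ℝ (χ n) x e ∂μ := by
      rw [← setIntegral_eq_integral_of_forall_compl_eq_zero (s := U)]
      · refine setIntegral_congr_fun hU.measurableSet fun x hx => ?_
        by_cases hxK : x ∈ K
        · simp [hf₀K x hxK]
        · have : fderiv ℝ (χ n) x = 0 := by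
            by_contra h0
            exact hxK (hχK n (support_fderiv_subset ℝ h0))
          simp [this]
      · intro x hx
        have : fderiv ℝ (χ n) x = 0 := by
          by_contra h0
          exact hx (hδU (hχK n (support_fderiv_subset ℝ h0)))
        simp [this]
    rw [← h2, ← h3, h1]
    congr 2; ext x
    rw [hcomp]; simp only [hψdef, hfn]; ring
  -- Bounds uniform in `n`, needed for dominated convergence; `g` is only locally integrable.
  obtain ⟨B, hB⟩ := hf₀c.exists_bound_of_continuous hf₀
  have hconv : ∀ (n : ℕ) (w : F → ℝ) (C : ℝ), Continuous w → (∀ x, ‖w x‖ ≤ C) →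
      ∀ x, ‖((ρ n).normed μ ⋆[ContinuousLinearMap.lsmul ℝ ℝ, μ] w : F → ℝ) x‖ ≤ 3 * C := by
    intro n w C hw hC x
    have h1 : dist (((ρ n).normed μ ⋆[ContinuousLinearMap.lsmul ℝ ℝ, μ] w : F → ℝ) x) (w x)
        ≤ 2 * C := by
      refine (ρ n).dist_normed_convolution_le hw.aestronglyMeasurable fun y _ => ?_
      rw [dist_eq_norm]
      linarith [norm_sub_le (w y) (w x), hC x, hC y]
    rw [dist_eq_norm] at h1
    linarith [norm_le_norm_add_norm_sub' (((ρ n).normed μ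
      ⋆[ContinuousLinearMap.lsmul ℝ ℝ, μ] w : F → ℝ) x) (w x), hC x]
  have hfnB : ∀ n x, fn n x ∈ Icc (-(3 * B)) (3 * B) := fun n x => by
    have := hconv n f₀ B hf₀ hB x
    rwa [Real.norm_eq_abs, abs_le] at this
  obtain ⟨C, hC⟩ := (isCompact_Icc (a := -(3 * B)) (b := 3 * B)).exists_bound_of_continuousOn
    hΦ'.continuousOn
  obtain ⟨C₁, hC₁⟩ := (isCompact_Icc (a := -(3 * B)) (b := 3 * B)).exists_bound_of_continuousOn
    hΦc.continuousOn
  obtain ⟨D, hD⟩ := hφc.exists_bound_of_continuous hφs.continuous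
  have hχB : ∀ n x, ‖χ n x‖ ≤ 3 * (C * D) := fun n x => by
    refine hconv n (ψ n) (C * D) (hψc n) (fun y => ?_) x
    rw [hψdef, norm_mul]
    have := hC _ (hfnB n y)
    exact mul_le_mul this (hD y) (norm_nonneg _) ((norm_nonneg _).trans this)
  -- Joint convergence in `(n, x)` is what allows the second mollification, of the
  -- `n`-dependent functions `ψ n`.
  have hfnlim : ∀ x, Tendsto (fun z : ℕ × F => fn z.1 z.2) (atTop ×ˢ 𝓝 x) (𝓝 (f₀ x)) :=
    fun x => tendsto_uncurry_convolution μ hρ0 hf₀ x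
  have hψlim : ∀ x, Tendsto (fun z : ℕ × F => ψ z.1 z.2) (atTop ×ˢ 𝓝 x)
      (𝓝 (Φ' (f₀ x) * φ x)) := fun x =>
    ((hΦ'.tendsto _).comp (hfnlim x)).mul ((hφs.continuous.tendsto x).comp tendsto_snd)
  have hχlim : ∀ x, Tendsto (fun n => χ n x) atTop (𝓝 (Φ' (f₀ x) * φ x)) := fun x =>
    ContDiffBump.convolution_tendsto_right hρ0
      (Eventually.of_forall fun n => (hψc n).aestronglyMeasurable) (hψlim x) tendsto_const_nhds
  have hfnlim' : ∀ x, Tendsto (fun n => fn n x) atTop (𝓝 (f₀ x)) := fun x =>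
    (hfnlim x).comp (f := fun n : ℕ => (n, x)) (tendsto_id.prodMk tendsto_const_nhds)
  have hφdi : Integrable (fun x => fderiv ℝ φ x e) μ :=
    hφd.integrable_of_hasCompactSupport (hφc.fderiv_apply ℝ e)
  have lim1 : Tendsto (fun n => ∫ x, Φ (fn n x) * fderiv ℝ φ x e ∂μ) atTop
      (𝓝 (∫ x, Φ (f₀ x) * fderiv ℝ φ x e ∂μ)) := by
    refine tendsto_integral_of_dominated_convergence (fun x => C₁ * ‖fderiv ℝ φ x e‖)
      (fun n => ((hΦc.comp (hfns n).continuous).mul hφd).aestronglyMeasurable)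
      (hφdi.norm.const_mul C₁) (fun n => .of_forall fun x => ?_) (.of_forall fun x => ?_)
    · rw [norm_mul]
      exact mul_le_mul_of_nonneg_right (hC₁ _ (hfnB n x)) (norm_nonneg _)
    · exact ((hΦc.tendsto _).comp (hfnlim' x)).mul_const _
  have hgK : IntegrableOn g K μ := hg.integrableOn_compact_subset hδU hK
  have lim2 : Tendsto (fun n => ∫ x in U, g x * χ n x ∂μ) atTop
      (𝓝 (∫ x in U, g x * (Φ' (f₀ x) * φ x) ∂μ)) := by
    refine tendsto_integral_of_dominated_convergence
      (K.indicator fun x => ‖g x‖ * (3 * (C * D)))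
      (fun n => (hg.aestronglyMeasurable).mul (hχs n).continuous.aestronglyMeasurable)
      ?_ (fun n => .of_forall fun x => ?_) (.of_forall fun x => ?_)
    · have h1 : IntegrableOn (fun x => ‖g x‖ * (3 * (C * D))) K μ := hgK.norm.mul_const _
      exact (h1.integrable_indicator hK.measurableSet).restrict
    · by_cases hx : x ∈ K
      · rw [indicator_of_mem hx, norm_mul]
        exact mul_le_mul_of_nonneg_left (hχB n x) (norm_nonneg _)
      · rw [indicator_of_notMem hx,
          image_eq_zero_of_notMem_tsupport fun hx' => hx (hχK n hx')]
        simp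
    · exact (hχlim x).const_mul _
  have hfin := tendsto_nhds_unique (lim1.congr key) lim2.neg
  have e1 : ∫ x in U, Φ (f x) * fderiv ℝ φ x e ∂μ = ∫ x, Φ (f₀ x) * fderiv ℝ φ x e ∂μ := by
    have hz : ∀ x ∉ tsupport φ, fderiv ℝ φ x e = 0 := fun x hx => by
      have : fderiv ℝ φ x = 0 := by
        by_contra h0
        exact hx (support_fderiv_subset ℝ h0)
      simp [this]
    refine Eq.trans ?_ (setIntegral_eq_integral_of_forall_compl_eq_zero (s := U)
      fun x hx => by simp [hz x fun hx' => hx (hφU hx')])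
    refine setIntegral_congr_fun hU.measurableSet fun x _ => ?_
    by_cases hx : x ∈ tsupport φ
    · simp [hf₀K x (hφK hx)]
    · simp [hz x hx]
  rw [e1, hfin]
  congr 1
  refine setIntegral_congr_fun hU.measurableSet fun x _ => ?_
  by_cases hx : x ∈ tsupport φ
  · simp only [hf₀K x (hφK hx)]; ring
  · simp [image_eq_zero_of_notMem_tsupport hx]

end WeakDerivative

/-! ### Pointwise inequalities for the diffusion and the source -/

section Pointwise

lemma abs_rpow_sub_rpow_le {s M x y : ℝ} (hs : 1 ≤ s) (hx : x ∈ Icc 0 M) (hy : y ∈ Icc 0 M) :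
    |x ^ s - y ^ s| ≤ s * M ^ (s - 1) * |x - y| := by
  refine (convex_Icc 0 M).norm_image_sub_le_of_norm_hasDerivWithin_le (𝕜 := ℝ)
    (f := fun z : ℝ => z ^ s) (f' := fun z => s * z ^ (s - 1))
    (fun z _ => (Real.hasDerivAt_rpow_const (Or.inr hs)).hasDerivWithinAt) (fun z hz => ?_) hy hx
  have hz0 : 0 ≤ z ^ (s - 1) := Real.rpow_nonneg hz.1 _
  rw [Real.norm_eq_abs, abs_of_nonneg (by positivity)]
  exact mul_le_mul_of_nonneg_left (Real.rpow_le_rpow hz.1 hz.2 (by linarith)) (by linarith)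

/-- In the square, one factor `|x ^ q - y ^ q|` is compared with `|x - y|`, the other with
`|x ^ r - y ^ r|`, since `x ^ q = (x ^ r) ^ (q / r)`. -/
lemma sq_rpow_sub_rpow_le {r q M : ℝ} (hr : 1 ≤ r) (hq : r ≤ q) (hM : 0 < M) :
    ∃ C > 0, ∀ x ∈ Icc 0 M, ∀ y ∈ Icc 0 M,
      (x ^ q - y ^ q) ^ 2 ≤ C * ((x ^ r - y ^ r) * (x - y)) := by
  have hr0 : 0 < r := by linarith
  have hqr : 1 ≤ q / r := by rwa [one_le_div hr0]
  have hq0 : 0 < q := by linarith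
  refine ⟨(q * M ^ (q - 1)) * (q / r * (M ^ r) ^ (q / r - 1)), by positivity, fun x hx y hy => ?_⟩
  have hmem : ∀ z ∈ Icc 0 M, z ^ r ∈ Icc 0 (M ^ r) := fun z hz =>
    ⟨Real.rpow_nonneg hz.1 _, Real.rpow_le_rpow hz.1 hz.2 hr0.le⟩
  have h1 := abs_rpow_sub_rpow_le (hr.trans hq) hx hy
  have h2 := abs_rpow_sub_rpow_le hqr (hmem x hx) (hmem y hy)
  rw [← Real.rpow_mul hx.1, ← Real.rpow_mul hy.1, mul_div_cancel₀ _ hr0.ne'] at h2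
  have hsign : 0 ≤ (x ^ r - y ^ r) * (x - y) := by
    rcases le_total x y with h | h
    · exact mul_nonneg_of_nonpos_of_nonpos
        (sub_nonpos.2 (Real.rpow_le_rpow hx.1 h hr0.le)) (sub_nonpos.2 h)
    · exact mul_nonneg (sub_nonneg.2 (Real.rpow_le_rpow hy.1 h hr0.le)) (sub_nonneg.2 h)
  rw [← abs_of_nonneg hsign, abs_mul, ← sq_abs, sq]
  calc _ ≤ (q * M ^ (q - 1) * |x - y|)
          * (q / r * (M ^ r) ^ (q / r - 1) * |x ^ r - y ^ r|) :=
        mul_le_mul h1 h2 (abs_nonneg _) ((abs_nonneg _).trans h1)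
    _ = _ := by ring

/-- By the Cauchy–Schwarz inequality, the monotonicity of the `p`-Laplace vector field is at least
that of its radial part. -/
lemma radial_le_inner_flux_sub {E : Type*} [NormedAddCommGroup E] [InnerProductSpace ℝ E]
    {p : ℝ} (hp : 2 < p) (a b : E) :
    (‖a‖ ^ (p - 1) - ‖b‖ ^ (p - 1)) * (‖a‖ - ‖b‖)
      ≤ ‖a‖ ^ (p - 2) * inner ℝ a (a - b) - ‖b‖ ^ (p - 2) * inner ℝ b (a - b) := by
  have hpow : ∀ c : E, ‖c‖ ^ (p - 1) = ‖c‖ ^ (p - 2) * ‖c‖ := fun c => by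
    rw [← Real.rpow_add_one' (norm_nonneg _) (by linarith)]
    congr 1; ring
  rw [hpow, hpow, inner_sub_right, inner_sub_right, real_inner_self_eq_norm_sq,
    real_inner_self_eq_norm_sq, real_inner_comm a b]
  have h := mul_le_mul_of_nonneg_left (real_inner_le_norm a b)
    (add_nonneg (Real.rpow_nonneg (norm_nonneg a) (p - 2))
      (Real.rpow_nonneg (norm_nonneg b) (p - 2)))
  nlinarith [h]

/-- For bounded gradients, the source difference is absorbed by the diffusion, up to a term
that is quadratic in `s`. -/
lemma source_sub_mul_le {E : Type*} [NormedAddCommGroup E] [InnerProductSpace ℝ E]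
    {p q M : ℝ} (hp : 2 < p) (hq : p - 1 < q) (hM : 0 < M) :
    ∃ C > 0, ∀ a b : E, ‖a‖ ≤ M → ‖b‖ ≤ M → ∀ s : ℝ,
      (‖a‖ ^ q - ‖b‖ ^ q) * s
        ≤ 2 * (‖a‖ ^ (p - 2) * inner ℝ a (a - b) - ‖b‖ ^ (p - 2) * inner ℝ b (a - b))
          + C * s ^ 2 := by
  obtain ⟨C, hC, h⟩ := sq_rpow_sub_rpow_le (r := p - 1) (q := q) (by linarith) hq.le hM
  refine ⟨C, hC, fun a b ha hb s => ?_⟩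
  have h1 := (h ‖a‖ ⟨norm_nonneg _, ha⟩ ‖b‖ ⟨norm_nonneg _, hb⟩).trans
    (mul_le_mul_of_nonneg_left (radial_le_inner_flux_sub hp a b) hC.le)
  set d := ‖a‖ ^ q - ‖b‖ ^ q
  set I := ‖a‖ ^ (p - 2) * inner ℝ a (a - b) - ‖b‖ ^ (p - 2) * inner ℝ b (a - b)
  refine le_of_mul_le_mul_left ?_ hC
  nlinarith [sq_nonneg (2 * d - C * s), sq_nonneg (C * s)]

end Pointwise

/-! ### Weak gradients: uniqueness and boundedness -/

section Gradients

instance isAddHaarMeasure_volume_spaceTime (N : ℕ) :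
    (volume : Measure (EuclideanSpace ℝ (Fin N) × ℝ)).IsAddHaarMeasure :=
  Measure.prod.instIsAddHaarMeasure _ _

lemma integrableOn_mul_of_tsupport_subset {F : Type*} [NormedAddCommGroup F]
    [NormedSpace ℝ F] [MeasurableSpace F] [BorelSpace F] {μ : Measure F}
    {U : Set F} {f φ : F → ℝ} (hf : LocallyIntegrableOn f U μ) (hφ : Continuous φ)
    (hφc : HasCompactSupport φ) (hφU : tsupport φ ⊆ U) :
    IntegrableOn (fun x => f x * φ x) U μ := by
  have h1 : IntegrableOn (fun x => f x * φ x) (tsupport φ) μ :=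
    (hf.integrableOn_compact_subset hφU hφc).mul_continuousOn hφ.continuousOn hφc
  rw [integrableOn_iff_integrable_of_support_subset
    ((Function.support_mul_subset_right f φ).trans (subset_tsupport φ))] at h1
  exact h1.integrableOn

lemma HasWeakDirDeriv.sub {F : Type*} [NormedAddCommGroup F]
    [NormedSpace ℝ F] [MeasurableSpace F] [BorelSpace F] {μ : Measure F}
    {U : Set F} {e : F} {f₁ f₂ g₁ g₂ : F → ℝ}
    (hf₁ : LocallyIntegrableOn f₁ U μ) (hf₂ : LocallyIntegrableOn f₂ U μ)
    (hg₁ : LocallyIntegrableOn g₁ U μ) (hg₂ : LocallyIntegrableOn g₂ U μ)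
    (h₁ : HasWeakDirDeriv μ U e f₁ g₁) (h₂ : HasWeakDirDeriv μ U e f₂ g₂) :
    HasWeakDirDeriv μ U e (fun x => f₁ x - f₂ x) (fun x => g₁ x - g₂ x) := by
  intro φ hφ
  have hd : Continuous fun x => fderiv ℝ φ x e :=
    (hφ.1.continuous_fderiv (by simp)).clm_apply continuous_const
  have hds : tsupport (fun x => fderiv ℝ φ x e) ⊆ U :=
    (tsupport_fderiv_apply_subset ℝ e).trans hφ.2.2
  have hdc := hφ.2.1.fderiv_apply ℝ e
  simp_rw [sub_mul]
  rw [integral_sub (integrableOn_mul_of_tsupport_subset hf₁ hd hdc hds)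
    (integrableOn_mul_of_tsupport_subset hf₂ hd hdc hds),
    integral_sub (integrableOn_mul_of_tsupport_subset hg₁ hφ.1.continuous hφ.2.1 hφ.2.2)
    (integrableOn_mul_of_tsupport_subset hg₂ hφ.1.continuous hφ.2.1 hφ.2.2), h₁ φ hφ, h₂ φ hφ]
  ring

variable {N : ℕ} {Ω : Set (EuclideanSpace ℝ (Fin N))} {T : ℝ}

lemma LocallyIntegrableOn.euclidean_apply {G : EuclideanSpace ℝ (Fin N) → EuclideanSpace ℝ (Fin N)}
    (hG : LocallyIntegrableOn G Ω) (i : Fin N) : LocallyIntegrableOn (fun x => G x i) Ω := by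
  intro x hx
  obtain ⟨s, hs, hi⟩ := hG x hx
  exact ⟨s, hs, (EuclideanSpace.proj (𝕜 := ℝ) i).integrable_comp hi⟩

lemma HasWeakGradient.hasWeakDirDeriv {f : EuclideanSpace ℝ (Fin N) → ℝ}
    {G : EuclideanSpace ℝ (Fin N) → EuclideanSpace ℝ (Fin N)} (h : HasWeakGradient Ω f G)
    (i : Fin N) :
    HasWeakDirDeriv volume Ω (EuclideanSpace.single i 1) f (fun x => G x i) :=
  fun φ hφ => h.integral_eq φ hφ i

lemma HasWeakGradient.ae_eq (hΩ : IsOpen Ω) {f : EuclideanSpace ℝ (Fin N) → ℝ}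
    {G G' : EuclideanSpace ℝ (Fin N) → EuclideanSpace ℝ (Fin N)}
    (h : HasWeakGradient Ω f G) (h' : HasWeakGradient Ω f G') :
    ∀ᵐ x ∂(volume.restrict Ω), G x = G' x := by
  have hi : ∀ i : Fin N, ∀ᵐ x, x ∈ Ω → G x i - G' x i = 0 := by
    intro i
    have hG := LocallyIntegrableOn.euclidean_apply h.locallyIntegrable_grad i
    have hG' := LocallyIntegrableOn.euclidean_apply h'.locallyIntegrable_grad i
    refine hΩ.ae_eq_zero_of_integral_contDiff_smul_eq_zero (hG.sub hG') fun φ h1 h2 h3 => ?_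
    rw [← setIntegral_eq_integral_of_forall_compl_eq_zero (s := Ω) fun x hx => by
      rw [image_eq_zero_of_notMem_tsupport fun hx' => hx (h3 hx')]; simp]
    have e1 := h.integral_eq φ ⟨h1, h2, h3⟩ i
    rw [h'.integral_eq φ ⟨h1, h2, h3⟩ i, neg_inj] at e1
    have : ∀ x, φ x • (G x i - G' x i) = G x i * φ x - G' x i * φ x := fun x => by
      rw [smul_eq_mul]; ring
    simp_rw [this]
    rw [integral_sub (integrableOn_mul_of_tsupport_subset hG h1.continuous h2 h3)
      (integrableOn_mul_of_tsupport_subset hG' h1.continuous h2 h3), e1, sub_self]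
  rw [ae_restrict_iff' hΩ.measurableSet]
  filter_upwards [ae_all_iff.2 hi] with x hx hxΩ
  ext i
  exact sub_eq_zero.1 (hx i hxΩ)

lemma volume_restrict_cylinder (Ω : Set (EuclideanSpace ℝ (Fin N))) (T : ℝ) :
    (volume.restrict (cylinder Ω T) : Measure (EuclideanSpace ℝ (Fin N) × ℝ))
      = (volume.restrict Ω).prod (volume.restrict (Ioo 0 T)) := by
  rw [Measure.prod_restrict]; rfl

lemma ae_slice_of_ae_cylinder {P : EuclideanSpace ℝ (Fin N) × ℝ → Prop}
    (h : ∀ᵐ z ∂(volume.restrict (cylinder Ω T)), P z) :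
    ∀ᵐ t ∂(volume.restrict (Ioo 0 T)), ∀ᵐ x ∂(volume.restrict Ω), P (x, t) := by
  rw [volume_restrict_cylinder] at h
  exact Measure.ae_ae_of_ae_prod
    (Measure.measurePreserving_swap.quasiMeasurePreserving.ae
      (μa := (volume.restrict (Ioo 0 T)).prod (volume.restrict Ω)) h)

/-- The spatial gradient is determined almost everywhere by the function, whatever the exponents
of the two spaces it is considered in. -/
lemma HasSpatialGradient.ae_eq (hΩ : IsOpen Ω) {r r' : ℝ≥0∞}
    {u : EuclideanSpace ℝ (Fin N) × ℝ → ℝ}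
    {Du Du' : EuclideanSpace ℝ (Fin N) × ℝ → EuclideanSpace ℝ (Fin N)}
    (h : HasSpatialGradient Ω T r u Du) (h' : HasSpatialGradient Ω T r' u Du') :
    Du =ᵐ[volume.restrict (cylinder Ω T)] Du' := by
  obtain ⟨D, hD, hDe⟩ := h.memLp_grad.aestronglyMeasurable
  obtain ⟨D', hD', hDe'⟩ := h'.memLp_grad.aestronglyMeasurable
  suffices H : D =ᵐ[volume.restrict (cylinder Ω T)] D' from hDe.trans (H.trans hDe'.symm)
  have hS : MeasurableSet {z | D z = D' z} := hD.measurableSet_eq_fun hD'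
  have hsl : ∀ᵐ t ∂(volume.restrict (Ioo 0 T)), ∀ᵐ x ∂(volume.restrict Ω),
      D (x, t) = D' (x, t) := by
    filter_upwards [h.weakGradient, h'.weakGradient, ae_slice_of_ae_cylinder hDe,
      ae_slice_of_ae_cylinder hDe'] with t h1 h2 h3 h4
    filter_upwards [h1.ae_eq hΩ h2, h3, h4] with x h5 h6 h7
    rw [← h6, ← h7, h5]
  rw [EventuallyEq, volume_restrict_cylinder, Measure.ae_prod_iff_ae_ae hS,
    Measure.ae_ae_comm hS]
  exact hsl

lemma HasSpatialGradient.exists_norm_le (hΩ : IsOpen Ω) {r : ℝ≥0∞}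
    {u : EuclideanSpace ℝ (Fin N) × ℝ → ℝ}
    {Du : EuclideanSpace ℝ (Fin N) × ℝ → EuclideanSpace ℝ (Fin N)}
    (h : HasSpatialGradient Ω T r u Du) (hu : MemLpW1 Ω T ⊤ u) :
    ∃ M, ∀ᵐ z ∂(volume.restrict (cylinder Ω T)), ‖Du z‖ ≤ M := by
  obtain ⟨Du', h'⟩ := hu
  have hfin : eLpNormEssSup Du' (volume.restrict (cylinder Ω T)) ≠ ⊤ := by
    simpa using h'.memLp_grad.eLpNorm_ne_top
  refine ⟨(eLpNormEssSup Du' (volume.restrict (cylinder Ω T))).toReal, ?_⟩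
  filter_upwards [h.ae_eq hΩ h', ae_le_eLpNormEssSup (f := Du')
    (μ := volume.restrict (cylinder Ω T))] with z h1 h2
  rw [h1, ← toReal_enorm]
  exact ENNReal.toReal_mono hfin h2

lemma isFiniteMeasure_restrict_cylinder (hΩ : Bornology.IsBounded Ω) :
    IsFiniteMeasure (volume.restrict (cylinder Ω T)) :=
  isFiniteMeasure_restrict.2
    ((hΩ.prod (Metric.isBounded_Ioo 0 T)).measure_lt_top).ne

lemma isOpen_cylinder (hΩ : IsOpen Ω) : IsOpen (cylinder Ω T) := hΩ.prod isOpen_Ioo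

end Gradients

/-! ### Truncations of the difference of two functions -/

section Truncation

lemma hasDerivAt_max_sub_zero_pow (n : ℕ) (ε s : ℝ) :
    HasDerivAt (fun s => max (s - ε) 0 ^ (n + 2)) ((n + 2) * max (s - ε) 0 ^ (n + 1)) s := by
  have h0 : ∀ y : ℝ, HasDerivAt (fun y : ℝ => max y 0 ^ (n + 2))
      ((n + 2) * max y 0 ^ (n + 1)) y := by
    intro y
    rcases lt_trichotomy y 0 with hy | rfl | hy
    · rw [max_eq_right hy.le]
      refine (by simpa using hasDerivAt_const y (0 : ℝ) :
        HasDerivAt (fun _ : ℝ => (0 : ℝ)) _ y).congr_of_eventuallyEq ?_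
      filter_upwards [Iio_mem_nhds hy] with z hz
      simp [max_eq_right (le_of_lt (mem_Iio.1 hz))]
    · rw [hasDerivAt_iff_tendsto_slope]
      have hc : Tendsto (fun y : ℝ => max y 0 ^ (n + 1)) (𝓝[≠] 0)
          (𝓝 ((n + 2) * max (0 : ℝ) 0 ^ (n + 1))) := by
        have : Continuous fun y : ℝ => max y 0 ^ (n + 1) := by fun_prop
        simpa using (this.tendsto 0).mono_left nhdsWithin_le_nhds
      refine hc.congr' ?_
      filter_upwards [self_mem_nhdsWithin] with z hz
      have hz : z ≠ 0 := hz
      rcases le_total z 0 with h | h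
      · simp [slope_def_field, max_eq_right h]
      · rw [slope_def_field, max_eq_left h]
        field_simp
        simp [pow_succ]
    · rw [max_eq_left hy.le]
      have := hasDerivAt_pow (n + 2) y
      push_cast at this
      refine this.congr_of_eventuallyEq ?_
      filter_upwards [Ioi_mem_nhds hy] with z hz
      rw [max_eq_left (le_of_lt (mem_Ioi.1 hz))]
  have h1 := HasDerivAt.comp (h := fun x : ℝ => x - ε) s (h0 (s - ε))
    ((hasDerivAt_id s).sub_const ε)
  rw [mul_one] at h1
  exact h1

/-- A smooth nonincreasing cutoff in time that is positive exactly before the time `s`, and decays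
at the relative rate `κ` or faster. The exponential factor replaces Grönwall's lemma. -/
lemma exists_time_cutoff (κ s : ℝ) : ∃ η : ℝ → ℝ, ContDiff ℝ ∞ η ∧ (∀ t, 0 ≤ η t) ∧
    (∀ t, s ≤ t → η t = 0) ∧ (∀ t, s ≤ t → deriv η t = 0) ∧ (∀ t < s, 0 < η t) ∧
    ∀ t, κ * η t ≤ - deriv η t := by
  have h0 : ∀ t, s ≤ t → Real.exp (-(κ * t)) * Real.smoothTransition (s - t) = 0 := fun t ht => by
    rw [Real.smoothTransition.zero_of_nonpos (by linarith), mul_zero]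
  have hsm : ContDiff ℝ ∞ fun t => Real.exp (-(κ * t)) * Real.smoothTransition (s - t) :=
    (Real.contDiff_exp.comp (contDiff_const.mul contDiff_id).neg).mul
      ((Real.smoothTransition.contDiff (n := ⊤)).comp (contDiff_const.sub contDiff_id))
  have hd : ∀ t, deriv (fun t => Real.exp (-(κ * t)) * Real.smoothTransition (s - t)) t
      = -(κ * (Real.exp (-(κ * t)) * Real.smoothTransition (s - t)))
        - Real.exp (-(κ * t)) * deriv Real.smoothTransition (s - t) := by
    intro t
    have h1 : HasDerivAt (fun t => Real.exp (-(κ * t))) (Real.exp (-(κ * t)) * (-(κ * 1))) t :=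
      ((hasDerivAt_id t).const_mul κ).neg.exp
    have h2 : HasDerivAt (fun t => Real.smoothTransition (s - t))
        (deriv Real.smoothTransition (s - t) * (-1)) t :=
      HasDerivAt.comp t ((Real.smoothTransition.contDiff (n := 1)).differentiable
        (by simp) (s - t)).hasDerivAt ((hasDerivAt_id t).const_sub s)
    refine (h1.mul h2).deriv.trans ?_
    ring
  have hle : ∀ t, κ * (Real.exp (-(κ * t)) * Real.smoothTransition (s - t))
      ≤ - deriv (fun t => Real.exp (-(κ * t)) * Real.smoothTransition (s - t)) t := fun t => by
    rw [hd]
    have := mul_nonneg (Real.exp_pos (-(κ * t))).le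
      (Real.smoothTransition.monotone.deriv_nonneg (x := s - t))
    linarith
  refine ⟨_, hsm, fun t => mul_nonneg (Real.exp_pos _).le (Real.smoothTransition.nonneg _), h0, ?_,
    fun t ht => mul_pos (Real.exp_pos _) (Real.smoothTransition.pos_of_pos (by linarith)), hle⟩
  intro t ht
  -- The cutoff attains its minimum `0` at `t`.
  refine IsLocalMin.deriv_eq_zero (Eventually.of_forall fun y => ?_)
  simp only [h0 t ht]
  exact mul_nonneg (Real.exp_pos _).le (Real.smoothTransition.nonneg _)

/-- The function `((w - ε)⁺)ⁿ η(t)` on `Q`, extended by zero. -/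
noncomputable def truncation {F : Type*} (Q : Set (F × ℝ)) (w : F × ℝ → ℝ) (ε : ℝ)
    (η : ℝ → ℝ) (n : ℕ) : F × ℝ → ℝ :=
  Q.indicator fun z => max (w z - ε) 0 ^ n * η z.2

section Support

variable {F : Type*} [TopologicalSpace F] [T2Space F] {Q K : Set (F × ℝ)}
  {w : F × ℝ → ℝ} {ε s : ℝ} {η : ℝ → ℝ} {n : ℕ}

omit [TopologicalSpace F] [T2Space F] in
lemma truncation_eq_zero (hn : n ≠ 0) (hη : ∀ t, s ≤ t → η t = 0)
    (hwK : ∀ z ∈ Q, z ∉ K → w z ≤ ε ∨ s ≤ z.2) {z : F × ℝ} (hz : z ∉ K) :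
    truncation Q w ε η n z = 0 := by
  by_cases hzQ : z ∈ Q
  · rw [truncation, indicator_of_mem hzQ]
    rcases hwK z hzQ hz with h | h
    · rw [max_eq_right (by linarith), zero_pow hn, zero_mul]
    · rw [hη _ h, mul_zero]
  · rw [truncation, indicator_of_notMem hzQ]

lemma hasCompactSupport_truncation (hn : n ≠ 0) (hη : ∀ t, s ≤ t → η t = 0) (hK : IsCompact K)
    (hwK : ∀ z ∈ Q, z ∉ K → w z ≤ ε ∨ s ≤ z.2) :
    HasCompactSupport (truncation Q w ε η n) :=
  HasCompactSupport.intro hK fun _ hz => truncation_eq_zero hn hη hwK hz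

lemma continuous_truncation (hn : n ≠ 0) (hηc : Continuous η) (hη : ∀ t, s ≤ t → η t = 0)
    (hQ : IsOpen Q) (hK : IsCompact K) (hKQ : K ⊆ Q) (hw : ContinuousOn w Q)
    (hwK : ∀ z ∈ Q, z ∉ K → w z ≤ ε ∨ s ≤ z.2) :
    Continuous (truncation Q w ε η n) := by
  refine continuous_iff_continuousAt.2 fun z => ?_
  by_cases hz : z ∈ K
  · have hzQ := hQ.mem_nhds (hKQ hz)
    have h1 : ContinuousAt (fun z => max (w z - ε) 0 ^ n * η z.2) z :=
      ((((hw.continuousAt hzQ).sub continuousAt_const).max continuousAt_const).pow n).mul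
        (hηc.comp continuous_snd).continuousAt
    refine h1.congr ?_
    filter_upwards [hzQ] with y hy
    rw [truncation, indicator_of_mem hy]
  · refine (continuousAt_const (y := (0 : ℝ))).congr ?_
    filter_upwards [hK.isClosed.isOpen_compl.mem_nhds hz] with y hy
    exact (truncation_eq_zero hn hη hwK hy).symm

end Support

variable {N : ℕ} {Ω : Set (EuclideanSpace ℝ (Fin N))} {T : ℝ}

/-- A continuous function that is nonpositive on the parabolic boundary exceeds `ε > 0` before the
time `s < T` only in a compact subset of the cylinder. -/
lemma exists_compact_superlevel (hΩ : IsOpen Ω) (hΩb : Bornology.IsBounded Ω) (hT : 0 < T)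
    {w : EuclideanSpace ℝ (Fin N) × ℝ → ℝ} (hw : ContinuousOn w (closure Ω ×ˢ Ico 0 T))
    (hinit : ∀ᵐ x ∂(volume.restrict Ω), w (x, 0) ≤ 0)
    (hbd : ∀ x ∈ frontier Ω, ∀ t ∈ Ioo 0 T, w (x, t) ≤ 0) {ε s : ℝ} (hε : 0 < ε) (hs : s < T) :
    ∃ K, IsCompact K ∧ K ⊆ cylinder Ω T ∧
      ∀ z ∈ cylinder Ω T, z ∉ K → w z ≤ ε ∨ s ≤ z.2 := by
  have hw0 : ContinuousOn (fun x => w (x, 0)) (closure Ω) :=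
    hw.comp (by fun_prop) fun x hx => ⟨hx, le_rfl, hT⟩
  have hinit' : ∀ x ∈ closure Ω, w (x, 0) ≤ 0 := by
    refine fun x hx => le_on_closure (fun y hy => ?_) hw0 continuousOn_const hx
    have hae : (fun x => max (w (x, 0)) 0) =ᵐ[volume.restrict Ω] fun _ => 0 := by
      filter_upwards [hinit] with x hx using max_eq_right hx
    exact max_eq_right_iff.1 (Measure.eqOn_open_of_ae_eq hae hΩ
      ((hw0.mono subset_closure).sup continuousOn_const) continuousOn_const hy)
  have hcl : IsCompact (closure Ω ×ˢ Icc 0 s) := hΩb.isCompact_closure.prod isCompact_Icc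
  have hws : ContinuousOn w (closure Ω ×ˢ Icc 0 s) :=
    hw.mono (prod_mono subset_rfl fun t ht => ⟨ht.1, ht.2.trans_lt hs⟩)
  refine ⟨(closure Ω ×ˢ Icc 0 s) ∩ w ⁻¹' Ici ε, hcl.of_isClosed_subset
    (hws.preimage_isClosed_of_isClosed hcl.isClosed isClosed_Ici) inter_subset_left, ?_, ?_⟩
  · rintro ⟨x, t⟩ ⟨⟨hx, ht⟩, hwx⟩
    have hwx : ε ≤ w (x, t) := hwx
    have ht0 : 0 < t := by
      refine lt_of_le_of_ne ht.1 ?_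
      rintro rfl
      linarith [hinit' x hx]
    have htI : t ∈ Ioo 0 T := ⟨ht0, ht.2.trans_lt hs⟩
    refine ⟨?_, htI⟩
    rw [closure_eq_self_union_frontier] at hx
    rcases hx with hx | hx
    · exact hx
    · linarith [hbd x hx t htI]
  · intro z hz hzK
    by_contra! h
    exact hzK ⟨⟨subset_closure hz.1, hz.2.1.le, h.2.le⟩, h.1.le⟩

variable {u v : EuclideanSpace ℝ (Fin N) × ℝ → ℝ}
  {Du Dv : EuclideanSpace ℝ (Fin N) × ℝ → EuclideanSpace ℝ (Fin N)} {r : ℝ≥0∞}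
  {K : Set (EuclideanSpace ℝ (Fin N) × ℝ)} {ε s M : ℝ} {η : ℝ → ℝ}

/-- The square in the test function `((u - v - ε)⁺)² η` keeps the truncation of class `C¹`, so that
its gradient comes from the chain rule for `C¹` functions. -/
lemma isAdmissible_truncation (p : ℝ) (hΩ : IsOpen Ω) (hΩb : Bornology.IsBounded Ω)
    (hu : ContinuousOn u (cylinder Ω T)) (hv : ContinuousOn v (cylinder Ω T))
    (hDu : HasSpatialGradient Ω T r u Du) (hDv : HasSpatialGradient Ω T r v Dv)
    (hMu : ∀ᵐ z ∂(volume.restrict (cylinder Ω T)), ‖Du z‖ ≤ M)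
    (hMv : ∀ᵐ z ∂(volume.restrict (cylinder Ω T)), ‖Dv z‖ ≤ M)
    (hηc : Continuous η) (hη0 : ∀ t, 0 ≤ η t) (hη : ∀ t, s ≤ t → η t = 0)
    (hK : IsCompact K) (hKQ : K ⊆ cylinder Ω T)
    (hwK : ∀ z ∈ cylinder Ω T, z ∉ K → u z - v z ≤ ε ∨ s ≤ z.2) :
    IsAdmissible p Ω T (truncation (cylinder Ω T) (fun z => u z - v z) ε η 2)
      (fun z => (2 * truncation (cylinder Ω T) (fun z => u z - v z) ε η 1 z)
        • (Du z - Dv z)) := by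
  have := isFiniteMeasure_restrict_cylinder (T := T) hΩb
  have hQ := isOpen_cylinder (T := T) hΩ
  have hw : ContinuousOn (fun z => u z - v z) (cylinder Ω T) := hu.sub hv
  have hc : ∀ n ≠ 0, Continuous (truncation (cylinder Ω T) (fun z => u z - v z) ε η n) :=
    fun n hn => continuous_truncation hn hηc hη hQ hK hKQ hw hwK
  have hcs : ∀ n ≠ 0, HasCompactSupport (truncation (cylinder Ω T) (fun z => u z - v z) ε η n) :=
    fun n hn => hasCompactSupport_truncation hn hη hK hwK
  refine ⟨(hc 2 two_ne_zero).continuousOn, ⟨?_, ?_, ?_⟩, ?_, ?_⟩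
  · exact ((hc 2 two_ne_zero).memLp_of_hasCompactSupport (hcs 2 two_ne_zero)).restrict _
  · obtain ⟨B, hB⟩ := (hcs 1 one_ne_zero).exists_bound_of_continuous (hc 1 one_ne_zero)
    refine MemLp.of_bound (((hc 1 one_ne_zero).const_mul 2).aestronglyMeasurable.smul
      (hDu.memLp_grad.aestronglyMeasurable.sub hDv.memLp_grad.aestronglyMeasurable))
      ((2 * B) * (M + M)) ?_
    filter_upwards [hMu, hMv] with z h1 h2
    rw [norm_smul, norm_mul, Real.norm_two]
    have h3 : ‖Du z - Dv z‖ ≤ M + M := (norm_sub_le _ _).trans (add_le_add h1 h2)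
    have hB0 : 0 ≤ B := (norm_nonneg _).trans (hB z)
    exact mul_le_mul (by linarith [hB z]) h3 (norm_nonneg _) (by positivity)
  · filter_upwards [hDu.weakGradient, hDv.weakGradient,
      ae_restrict_mem (measurableSet_Ioo (a := (0 : ℝ)) (b := T))] with t h1 h2 ht
    have hslice : Continuous fun x : EuclideanSpace ℝ (Fin N) => (x, t) := by fun_prop
    have htr : ∀ n, ∀ x ∈ Ω, truncation (cylinder Ω T) (fun z => u z - v z) ε η n (x, t)
        = max (u (x, t) - v (x, t) - ε) 0 ^ n * η t := fun n x hx => by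
      
      have hz : (x, t) ∈ cylinder Ω T := ⟨hx, ht⟩
      rw [truncation, indicator_of_mem hz]
    have hwc : ContinuousOn (fun x => u (x, t) - v (x, t)) Ω :=
      hw.comp hslice.continuousOn fun x hx => ⟨hx, ht⟩
    refine ⟨?_, ?_, fun φ hφ i => ?_⟩
    · exact ((hc 2 two_ne_zero).comp hslice).locallyIntegrable.locallyIntegrableOn _
    · exact (h1.locallyIntegrable_grad.sub h2.locallyIntegrable_grad).continuousOn_smul
        hΩ.isLocallyClosed (((hc 1 one_ne_zero).comp hslice).const_mul 2).continuousOn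
    · have hG1 := LocallyIntegrableOn.euclidean_apply h1.locallyIntegrable_grad i
      have hG2 := LocallyIntegrableOn.euclidean_apply h2.locallyIntegrable_grad i
      have hch := (HasWeakDirDeriv.sub h1.locallyIntegrable h2.locallyIntegrable hG1 hG2
        (h1.hasWeakDirDeriv i) (h2.hasWeakDirDeriv i)).comp volume hΩ hwc (hG1.sub hG2)
        (hasDerivAt_max_sub_zero_pow 0 ε) (by fun_prop) φ hφ
      rw [setIntegral_congr_fun (g := fun x => η t *
        (max (u (x, t) - v (x, t) - ε) 0 ^ (0 + 2) * fderiv ℝ φ x (EuclideanSpace.single i 1)))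
        hΩ.measurableSet (fun x hx => by simp only [htr 2 x hx]; ring), integral_const_mul, hch,
        mul_neg, ← integral_const_mul]
      congr 1
      refine setIntegral_congr_fun hΩ.measurableSet fun x hx => ?_
      simp only [htr 1 x hx, Pi.sub_apply, PiLp.smul_apply, PiLp.sub_apply, smul_eq_mul]
      push_cast
      ring
  · intro z _
    refine indicator_nonneg (fun z _ => mul_nonneg (by positivity) (hη0 _)) z
  · intro x hx t _
    refine indicator_of_notMem (fun h => ?_) _
    rw [hΩ.frontier_eq] at hx
    exact hx.2 h.1

/-- Integration by parts in time: `∬ ((w - ε)⁺)³ η' = - 3 ∬ wₜ ((w - ε)⁺)² η`. -/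
lemma integral_truncation_deriv (hΩ : IsOpen Ω) (hΩb : Bornology.IsBounded Ω)
    {ut vt : EuclideanSpace ℝ (Fin N) × ℝ → ℝ}
    (hu : ContinuousOn u (cylinder Ω T)) (hv : ContinuousOn v (cylinder Ω T))
    (hut : HasL2TimeDeriv Ω T u ut) (hvt : HasL2TimeDeriv Ω T v vt)
    (hηs : ContDiff ℝ ∞ η) (hη : ∀ t, s ≤ t → η t = 0) (hη' : ∀ t, s ≤ t → deriv η t = 0)
    (hK : IsCompact K) (hKQ : K ⊆ cylinder Ω T)
    (hwK : ∀ z ∈ cylinder Ω T, z ∉ K → u z - v z ≤ ε ∨ s ≤ z.2) :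
    ∫ z in cylinder Ω T, truncation (cylinder Ω T) (fun z => u z - v z) ε (deriv η) 3 z
      = - (3 * ∫ z in cylinder Ω T,
        (ut z - vt z) * truncation (cylinder Ω T) (fun z => u z - v z) ε η 2 z) := by
  have := isFiniteMeasure_restrict_cylinder (T := T) hΩb
  have hQ := isOpen_cylinder (T := T) hΩ
  obtain ⟨θ, ⟨hθs, hθc, hθQ⟩, hθ1⟩ := exists_isTestFunction_eq_one hK hQ hKQ
  have hli : ∀ {f : EuclideanSpace ℝ (Fin N) × ℝ → ℝ}, MemLp f 2 (volume.restrict (cylinder Ω T)) →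
      LocallyIntegrableOn f (cylinder Ω T) volume := fun hf =>
    IntegrableOn.locallyIntegrableOn (hf.integrable (by norm_num))
  have hη2 : ContDiff ℝ ∞ fun z : EuclideanSpace ℝ (Fin N) × ℝ => η z.2 := hηs.comp contDiff_snd
  have hφ : IsTestFunction (cylinder Ω T) fun z => θ z * η z.2 :=
    ⟨hθs.mul hη2, hθc.mul_right, (tsupport_mul_subset_left).trans hθQ⟩
  have hfd : ∀ z : EuclideanSpace ℝ (Fin N) × ℝ,
      HasFDerivAt (fun z : EuclideanSpace ℝ (Fin N) × ℝ => η z.2)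
        (deriv η z.2 • ContinuousLinearMap.snd ℝ (EuclideanSpace ℝ (Fin N)) ℝ) z := fun z =>
    ((hηs.differentiable (by simp) z.2).hasDerivAt).comp_hasFDerivAt z hasFDerivAt_snd
  have hch := (HasWeakDirDeriv.sub (hu.locallyIntegrableOn hQ.measurableSet)
    (hv.locallyIntegrableOn hQ.measurableSet) (hli hut.memLp) (hli hvt.memLp)
    hut.integral_eq hvt.integral_eq).comp volume hQ (hu.sub hv)
    ((hli hut.memLp).sub (hli hvt.memLp)) (hasDerivAt_max_sub_zero_pow 1 ε) (by fun_prop) _ hφ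
  rw [← integral_const_mul]
  refine Eq.trans ?_ (hch.trans ?_)
  · refine setIntegral_congr_fun hQ.measurableSet fun z hz => ?_
    simp only [truncation, indicator_of_mem hz]
    by_cases hzK : z ∈ K
    · have hev : (fun z => θ z * η z.2) =ᶠ[𝓝 z] fun z => η z.2 := by
        filter_upwards [eventually_nhdsSet_iff_forall.1 hθ1 z hzK] with y hy
        rw [hy, one_mul]
      rw [hev.fderiv_eq, (hfd z).fderiv]
      simp
    · rcases hwK z hz hzK with h | h
      · simp [max_eq_right (sub_nonpos.2 h)]
      · have hprod : HasFDerivAt (fun z => θ z * η z.2) _ z :=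
          (hθs.differentiable (by simp) z).hasFDerivAt.mul (hfd z)
        rw [hprod.fderiv]
        simp [hη _ h, hη' _ h]
  · congr 1
    refine setIntegral_congr_fun hQ.measurableSet fun z hz => ?_
    simp only [truncation, indicator_of_mem hz]
    by_cases hzK : z ∈ K
    · rw [hθ1.self_of_nhdsSet z hzK, Pi.sub_apply, Pi.sub_apply]
      push_cast
      ring
    · rcases hwK z hz hzK with h | h
      · simp [max_eq_right (sub_nonpos.2 h)]
      · simp [hη _ h]

end Truncation

/-! ### Energy estimate and comparison -/

section Comparison

variable {N : ℕ} {Ω : Set (EuclideanSpace ℝ (Fin N))} {T : ℝ}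

lemma integrable_flux_mul {p M B : ℝ} (hΩb : Bornology.IsBounded Ω) (hp : 2 < p) (hM : 0 ≤ M)
    {Du Dψ : EuclideanSpace ℝ (Fin N) × ℝ → EuclideanSpace ℝ (Fin N)}
    (hDu : AEStronglyMeasurable Du (volume.restrict (cylinder Ω T)))
    (hDψ : AEStronglyMeasurable Dψ (volume.restrict (cylinder Ω T)))
    (hMu : ∀ᵐ z ∂(volume.restrict (cylinder Ω T)), ‖Du z‖ ≤ M)
    (hB : ∀ᵐ z ∂(volume.restrict (cylinder Ω T)), ‖Dψ z‖ ≤ B) :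
    IntegrableOn (fun z => ‖Du z‖ ^ (p - 2) * inner ℝ (Du z) (Dψ z)) (cylinder Ω T) := by
  have := isFiniteMeasure_restrict_cylinder (T := T) hΩb
  refine Integrable.of_bound
    ((hDu.norm.aemeasurable.pow_const _).aestronglyMeasurable.mul (hDu.inner hDψ))
    (M ^ (p - 2) * (M * B)) ?_
  filter_upwards [hMu, hB] with z h1 h2
  rw [norm_mul, Real.norm_of_nonneg (Real.rpow_nonneg (norm_nonneg _) _)]
  refine mul_le_mul (Real.rpow_le_rpow (norm_nonneg _) h1 (by linarith)) ?_ (norm_nonneg _)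
    (Real.rpow_nonneg hM _)
  exact (norm_inner_le_norm _ _).trans (mul_le_mul h1 h2 (norm_nonneg _) hM)

lemma integrable_source_mul {q M : ℝ} (hq : 0 < q)
    {Du : EuclideanSpace ℝ (Fin N) × ℝ → EuclideanSpace ℝ (Fin N)}
    {ψ : EuclideanSpace ℝ (Fin N) × ℝ → ℝ}
    (hDu : AEStronglyMeasurable Du (volume.restrict (cylinder Ω T)))
    (hMu : ∀ᵐ z ∂(volume.restrict (cylinder Ω T)), ‖Du z‖ ≤ M)
    (hψ : IntegrableOn ψ (cylinder Ω T)) :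
    IntegrableOn (fun z => ‖Du z‖ ^ q * ψ z) (cylinder Ω T) := by
  refine Integrable.bdd_mul (c := M ^ q) hψ
    (hDu.norm.aemeasurable.pow_const _).aestronglyMeasurable ?_
  filter_upwards [hMu] with z h1
  rw [Real.norm_of_nonneg (Real.rpow_nonneg (norm_nonneg _) _)]
  exact Real.rpow_le_rpow (norm_nonneg _) h1 hq.le

/-- The energy inequality: testing both weak formulations with `((u - v - ε)⁺)² η`, the diffusion
absorbs the difference of the gradient terms. -/
lemma integral_time_deriv_mul_le {p q M C ε s : ℝ} (hΩ : IsOpen Ω) (hΩb : Bornology.IsBounded Ω)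
    (hp : 2 < p) (hq : p - 1 < q) (hM : 0 ≤ M)
    (hC : ∀ a b : EuclideanSpace ℝ (Fin N), ‖a‖ ≤ M → ‖b‖ ≤ M → ∀ s : ℝ,
      (‖a‖ ^ q - ‖b‖ ^ q) * s
        ≤ 2 * (‖a‖ ^ (p - 2) * inner ℝ a (a - b) - ‖b‖ ^ (p - 2) * inner ℝ b (a - b))
          + C * s ^ 2)
    {u v ut vt : EuclideanSpace ℝ (Fin N) × ℝ → ℝ} {r : ℝ≥0∞}
    {Du Dv : EuclideanSpace ℝ (Fin N) × ℝ → EuclideanSpace ℝ (Fin N)}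
    (hu : ContinuousOn u (cylinder Ω T)) (hv : ContinuousOn v (cylinder Ω T))
    (hDu : HasSpatialGradient Ω T r u Du) (hDv : HasSpatialGradient Ω T r v Dv)
    (hMu : ∀ᵐ z ∂(volume.restrict (cylinder Ω T)), ‖Du z‖ ≤ M)
    (hMv : ∀ᵐ z ∂(volume.restrict (cylinder Ω T)), ‖Dv z‖ ≤ M)
    (hut : HasL2TimeDeriv Ω T u ut) (hvt : HasL2TimeDeriv Ω T v vt)
    (hsub : ∀ ψ Dψ, IsAdmissible p Ω T ψ Dψ →
      diffusionForm p Ω T ut Du ψ Dψ ≤ sourceForm q Ω T Du ψ)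
    (hsuper : ∀ ψ Dψ, IsAdmissible p Ω T ψ Dψ →
      sourceForm q Ω T Dv ψ ≤ diffusionForm p Ω T vt Dv ψ Dψ)
    {η : ℝ → ℝ} (hηc : Continuous η) (hη0 : ∀ t, 0 ≤ η t) (hη : ∀ t, s ≤ t → η t = 0)
    {K : Set (EuclideanSpace ℝ (Fin N) × ℝ)} (hK : IsCompact K) (hKQ : K ⊆ cylinder Ω T)
    (hwK : ∀ z ∈ cylinder Ω T, z ∉ K → u z - v z ≤ ε ∨ s ≤ z.2) :
    ∫ z in cylinder Ω T,
        (ut z - vt z) * truncation (cylinder Ω T) (fun z => u z - v z) ε η 2 z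
      ≤ C * ∫ z in cylinder Ω T, truncation (cylinder Ω T) (fun z => u z - v z) ε η 3 z := by
  have := isFiniteMeasure_restrict_cylinder (T := T) hΩb
  have hQ := isOpen_cylinder (T := T) hΩ
  have hadm := isAdmissible_truncation p hΩ hΩb hu hv hDu hDv hMu hMv hηc hη0 hη hK hKQ hwK
  set S : ℕ → EuclideanSpace ℝ (Fin N) × ℝ → ℝ :=
    fun n => truncation (cylinder Ω T) (fun z => u z - v z) ε η n with hS
  set Dψ : EuclideanSpace ℝ (Fin N) × ℝ → EuclideanSpace ℝ (Fin N) :=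
    fun z => (2 * S 1 z) • (Du z - Dv z) with hDψ
  have hc : ∀ n ≠ 0, Continuous (S n) :=
    fun n hn => continuous_truncation hn hηc hη hQ hK hKQ (hu.sub hv) hwK
  have hcs : ∀ n ≠ 0, HasCompactSupport (S n) :=
    fun n hn => hasCompactSupport_truncation hn hη hK hwK
  have hi : ∀ n ≠ 0, IntegrableOn (S n) (cylinder Ω T) := fun n hn =>
    ((hc n hn).integrable_of_hasCompactSupport (hcs n hn)).integrableOn
  obtain ⟨B₂, hB₂⟩ := (hcs 2 two_ne_zero).exists_bound_of_continuous (hc 2 two_ne_zero)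
  obtain ⟨B₁, hB₁⟩ := (hcs 1 one_ne_zero).exists_bound_of_continuous (hc 1 one_ne_zero)
  have hmt : ∀ {f : EuclideanSpace ℝ (Fin N) × ℝ → ℝ}, MemLp f 2 (volume.restrict (cylinder Ω T)) →
      IntegrableOn (fun z => f z * S 2 z) (cylinder Ω T) := fun hf =>
    Integrable.mul_bdd (c := B₂) (hf.integrable (by norm_num))
      (hc 2 two_ne_zero).aestronglyMeasurable (.of_forall hB₂)
  have hmu := hDu.memLp_grad.aestronglyMeasurable
  have hmv := hDv.memLp_grad.aestronglyMeasurable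
  have hmψ := hadm.gradient.memLp_grad.aestronglyMeasurable
  have hbψ : ∀ᵐ z ∂(volume.restrict (cylinder Ω T)), ‖Dψ z‖ ≤ (2 * B₁) * (M + M) := by
    filter_upwards [hMu, hMv] with z h1 h2
    rw [hDψ, norm_smul, norm_mul, Real.norm_two]
    exact mul_le_mul (by linarith [hB₁ z]) ((norm_sub_le _ _).trans (add_le_add h1 h2))
      (norm_nonneg _) (by linarith [(norm_nonneg _).trans (hB₁ z)])
  have hfu := integrable_flux_mul hΩb hp hM hmu hmψ hMu hbψ
  have hfv := integrable_flux_mul hΩb hp hM hmv hmψ hMv hbψ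
  have hsu := integrable_source_mul (q := q) (by linarith) hmu hMu (hi 2 two_ne_zero)
  have hsv := integrable_source_mul (q := q) (by linarith) hmv hMv (hi 2 two_ne_zero)
  have h1 := hsub _ _ hadm
  have h2 := hsuper _ _ hadm
  rw [diffusionForm, sourceForm, integral_add (hmt hut.memLp) hfu] at h1
  rw [diffusionForm, sourceForm, integral_add (hmt hvt.memLp) hfv] at h2
  have hs2 : IntegrableOn (fun z => ‖Du z‖ ^ q * S 2 z - ‖Dv z‖ ^ q * S 2 z) (cylinder Ω T) :=
    hsu.sub hsv
  have hf2 : IntegrableOn (fun z => ‖Du z‖ ^ (p - 2) * inner ℝ (Du z) (Dψ z)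
      - ‖Dv z‖ ^ (p - 2) * inner ℝ (Dv z) (Dψ z)) (cylinder Ω T) := hfu.sub hfv
  have hpt : ∫ z in cylinder Ω T, ((‖Du z‖ ^ q * S 2 z - ‖Dv z‖ ^ q * S 2 z)
        - (‖Du z‖ ^ (p - 2) * inner ℝ (Du z) (Dψ z) - ‖Dv z‖ ^ (p - 2) * inner ℝ (Dv z) (Dψ z)))
      ≤ ∫ z in cylinder Ω T, C * S 3 z := by
    refine integral_mono_ae (hs2.sub hf2)
      ((hi 3 three_ne_zero).const_mul C) ?_
    filter_upwards [hMu, hMv, ae_restrict_mem hQ.measurableSet] with z h3 h4 hz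
    have h5 := hC _ _ h3 h4 (max (u z - v z - ε) 0)
    -- `ψ = S² η` and `Dψ = 2 S η (Du - Dv)` have the common factor `S η`, where `S = (u - v - ε)⁺`.
    have h6 := mul_le_mul_of_nonneg_left h5
      (mul_nonneg (le_max_right (u z - v z - ε) 0) (hη0 z.2))
    simp only [hDψ, inner_smul_right, hS, truncation, indicator_of_mem hz]
    linarith
  rw [integral_sub hs2 hf2, integral_sub hsu hsv, integral_sub hfu hfv,
    integral_const_mul] at hpt
  simp_rw [sub_mul]
  rw [integral_sub (hmt hut.memLp) (hmt hvt.memLp)]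
  linarith

end Comparison

end DegenerateHJ


theorem proposition2p1 {N : ℕ} (Ω : Set (EuclideanSpace ℝ (Fin N)))
    (hΩ_open : IsOpen Ω) (hΩ_bdd : Bornology.IsBounded Ω)
    (p q : ℝ) (hp : 2 < p) (hq : p - 1 < q) (T : ℝ) (hT : 0 < T)
    (g u₀ : EuclideanSpace ℝ (Fin N) → ℝ) (u v : EuclideanSpace ℝ (Fin N) × ℝ → ℝ)
    (hu : DegenerateHJ.IsWeakSubsolution p q Ω T g u₀ u)
    (hv : DegenerateHJ.IsWeakSupersolution p q Ω T g u₀ v)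
    (hu_lip : DegenerateHJ.MemLpW1 Ω T ⊤ u)
    (hv_lip : DegenerateHJ.MemLpW1 Ω T ⊤ v) :
    ∀ x ∈ Ω, ∀ t ∈ Set.Ioo 0 T, u (x, t) ≤ v (x, t) := by
  open DegenerateHJ in
  obtain ⟨huc, hui, hub, Du, ut, hDu, hut, hsub⟩ := hu
  obtain ⟨hvc, hvi, hvb, Dv, vt, hDv, hvt, hsuper⟩ := hv
  obtain ⟨Mu, hMu⟩ := hDu.exists_norm_le hΩ_open hu_lip
  obtain ⟨Mv, hMv⟩ := hDv.exists_norm_le hΩ_open hv_lip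
  obtain ⟨M, hM, hMu', hMv'⟩ : ∃ M > 0, Mu ≤ M ∧ Mv ≤ M :=
    ⟨max 1 (max Mu Mv), by positivity, by simp, by simp⟩
  replace hMu := hMu.mono fun z hz => hz.trans hMu'
  replace hMv := hMv.mono fun z hz => hz.trans hMv'
  obtain ⟨C, -, hC⟩ := source_sub_mul_le (E := EuclideanSpace ℝ (Fin N)) hp hq hM
  intro x hx t ht
  refine le_of_forall_pos_le_add fun ε hε => ?_
  obtain ⟨s, hts, hsT⟩ := exists_between ht.2
  have hQ := isOpen_cylinder (T := T) hΩ_open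
  have hsubset : cylinder Ω T ⊆ closure Ω ×ˢ Ico 0 T :=
    prod_mono subset_closure Ioo_subset_Ico_self
  obtain ⟨K, hK, hKQ, hwK⟩ := exists_compact_superlevel hΩ_open hΩ_bdd hT (huc.sub hvc)
    (by filter_upwards [hui, hvi] with y h1 h2 using sub_nonpos.2 (h1.trans h2))
    (fun y hy τ hτ => sub_nonpos.2 ((hub y hy τ hτ).trans (hvb y hy τ hτ))) hε hsT
  replace huc := huc.mono hsubset
  replace hvc := hvc.mono hsubset
  -- Rate `3 * C` balances the energy estimate after integration by parts in time; the extra `1`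
  -- makes the inequality strict.
  obtain ⟨η, hηs, hη0, hη, hη', hηpos, hdecay⟩ := exists_time_cutoff (3 * C + 1) s
  have henergy := integral_time_deriv_mul_le hΩ_open hΩ_bdd hp hq hM.le hC huc hvc hDu hDv hMu hMv
    hut hvt hsub hsuper hηs.continuous hη0 hη hK hKQ hwK
  have htime := integral_truncation_deriv hΩ_open hΩ_bdd huc hvc hut hvt hηs hη hη' hK hKQ hwK
  have hηd : Continuous (deriv η) := hηs.continuous_deriv (by simp)
  have hc : Continuous (truncation (cylinder Ω T) (fun z => u z - v z) ε η 3) :=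
    continuous_truncation three_ne_zero hηs.continuous hη hQ hK hKQ (huc.sub hvc) hwK
  have hi : IntegrableOn (truncation (cylinder Ω T) (fun z => u z - v z) ε η 3) (cylinder Ω T) :=
    (hc.integrable_of_hasCompactSupport
      (hasCompactSupport_truncation three_ne_zero hη hK hwK)).integrableOn
  have hid : IntegrableOn (truncation (cylinder Ω T) (fun z => u z - v z) ε (deriv η) 3)
      (cylinder Ω T) :=
    ((continuous_truncation three_ne_zero hηd hη' hQ hK hKQ
      (huc.sub hvc) hwK).integrable_of_hasCompactSupport
      (hasCompactSupport_truncation three_ne_zero hη' hK hwK)).integrableOn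
  have hdec : (3 * C + 1) * ∫ z in cylinder Ω T,
        truncation (cylinder Ω T) (fun z => u z - v z) ε η 3 z
      ≤ - ∫ z in cylinder Ω T,
        truncation (cylinder Ω T) (fun z => u z - v z) ε (deriv η) 3 z := by
    rw [← integral_const_mul, ← integral_neg]
    refine integral_mono_ae (hi.const_mul _) hid.neg (.of_forall fun z => ?_)
    by_cases hz : z ∈ cylinder Ω T
    · simp only [truncation, indicator_of_mem hz]
      have := mul_le_mul_of_nonneg_left (hdecay z.2)
        (pow_nonneg (le_max_right (u z - v z - ε) 0) 3)
      linarith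
    · simp [truncation, indicator_of_notMem hz]
  have hnonneg : ∀ z, 0 ≤ truncation (cylinder Ω T) (fun z => u z - v z) ε η 3 z :=
    indicator_nonneg fun z _ => mul_nonneg (by positivity) (hη0 _)
  have hint : ∫ z in cylinder Ω T, truncation (cylinder Ω T) (fun z => u z - v z) ε η 3 z = 0 :=
    le_antisymm (by linarith) (integral_nonneg hnonneg)
  have hae := (integral_eq_zero_iff_of_nonneg hnonneg hi).1 hint
  have hxt : (x, t) ∈ cylinder Ω T := ⟨hx, ht⟩
  -- The truncation vanishes almost everywhere, hence everywhere by continuity.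
  have hz := Measure.eqOn_open_of_ae_eq hae hQ hc.continuousOn continuousOn_const hxt
  rw [truncation, indicator_of_mem hxt] at hz
  have hmax := pow_eq_zero_iff three_ne_zero |>.1
    ((mul_eq_zero.1 hz).resolve_right (hηpos t hts).ne')
  linarith [max_eq_right_iff.1 hmax]
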